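/- **Theorem (Universal consistency of the nearest neighbor rule).** Let $(\mathcal X,\rho)$ be a separable metric space and $\nu$ a finite Borel measure on $\mathcal X$. Assume that $(\mathcal X,\rho,\nu)$ is *upper doubling*: there are real numbers $d\ge 0$ and $c>0$ such that, for every $x\in\mathcal X$ and $r>0$, the open ball $B(x,r)$ can be covered by at most $2^d$ closed balls of radius $r/2$, and $\nu(B(x,r))\le c\,r^d$. Let $\mathbb X=(X_n)_{n\ge 0}$ be a sequence of $\mathcal X$-valued random variables on a probability space that is *uniformly dominated* by $\nu$: for every $\epsilon>0$ there is $\delta>0$ such that, for every measurable $A\subset\mathcal X$ with $\nu(A)<\delta$, $$\sup_{n\ge 1}\Pr\big(X_n\in A \,\big|\, X_0,\dots,X_{n-1}\big)<\epsilon\qquad\text{almost surely.}$$ Let $\mathcal Y$ be a countable set of labels, in which every singleton is measurable. Then for every measurable $\eta:\mathcal X\to\mathcal Y$ the 1-nearest neighbor rule is *online consistent* with respect to $(\mathbb X,\eta)$: for every nearest neighbor process $(\tilde X_n)_{n\ge 1}$, that is, every choice (with ties broken arbitrarily) of $$\tilde X_n\in\operatorname*{arg\,min}_{x\in\{X_0,\dots,X_{n-1}\}}\rho(X_n,x)\qquad(n\ge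 1),$$ one has $$\lim_{N\to\infty}\frac1N\sum_{n=1}^N \mathbb 1\big\{\eta(X_n)\ne\eta(\tilde X_n)\big\}=0\qquad\text{almost surely.}$$ -/

import Mathlib

open MeasureTheory ProbabilityTheory Filter Topology

/-- A metric space is doubling with doubling dimension `d` if every ball of radius `r` is covered by
(at most) `2 ^ d` balls of radius `r / 2`.  The ball to be covered is open and the covering balls are
closed; this is the weakest of the possible open / closed conventions, and under it the space
`ℝ ^ d` with the sup distance has doubling dimension `d`. -/
def IsDoublingOfDim (𝒳 : Type*) [MetricSpace 𝒳] (d : ℝ) : Prop :=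
  ∀ (x : 𝒳) (r : ℝ), 0 < r →
    ∃ s : Finset 𝒳, (s.card : ℝ) ≤ (2 : ℝ) ^ d ∧
      Metric.ball x r ⊆ ⋃ y ∈ s, Metric.closedBall y (r / 2)

/-- A metric measure space is upper doubling if, for some `d`, it is doubling with doubling
dimension `d` and the measure of every ball of radius `r` is at most `c * r ^ d`. -/
def IsUpperDoubling {𝒳 : Type*} [MetricSpace 𝒳] [MeasurableSpace 𝒳] (ν : Measure 𝒳) : Prop :=
  ∃ d : ℝ, 0 ≤ d ∧ IsDoublingOfDim 𝒳 d ∧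
    ∃ c : ℝ, 0 < c ∧ ∀ (x : 𝒳) (r : ℝ), 0 < r →
      ν (Metric.ball x r) ≤ ENNReal.ofReal (c * r ^ d)

/-- The σ-algebra generated by the instances `X 0, …, X (n - 1)`. -/
abbrev pastSigma {Ω 𝒳 : Type*} [MeasurableSpace 𝒳] (X : ℕ → Ω → 𝒳) (n : ℕ) : MeasurableSpace Ω :=
  ⨆ m : ℕ, ⨆ _ : m < n, MeasurableSpace.comap (X m) inferInstance

/-- The process `X` is uniformly dominated by `ν`: for every `ε > 0` there is `δ > 0` such that
`ν A < δ` implies `sup_{n ≥ 1} Pr(X n ∈ A | X 0, …, X (n - 1)) < ε` almost surely.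
The supremum is taken in the extended reals.  The initial instance `X 0` is not constrained. -/
def IsUniformlyDominated {Ω 𝒳 : Type*} [MeasurableSpace Ω] [MeasurableSpace 𝒳]
    (X : ℕ → Ω → 𝒳) (μ : Measure Ω) (ν : Measure 𝒳) : Prop :=
  ∀ ε : ℝ, 0 < ε → ∃ δ : ℝ, 0 < δ ∧ ∀ A : Set 𝒳, MeasurableSet A → ν A < ENNReal.ofReal δ →
    ∀ᵐ ω ∂μ, (⨆ n : ℕ, ⨆ _ : 1 ≤ n, (((μ⟦X n ⁻¹' A | pastSigma X n⟧) ω : ℝ) : EReal)) < (ε : EReal)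

/-- The set of instances `X 0 ω, …, X (n - 1) ω` seen before time `n`. -/
def pastInstances {Ω 𝒳 : Type*} (X : ℕ → Ω → 𝒳) (n : ℕ) (ω : Ω) : Set 𝒳 :=
  (fun m => X m ω) '' Set.Iio n

/-- `Xt` is a nearest neighbor process of `X`: almost surely, for every `n ≥ 1`, the point `Xt n`
minimizes the distance to `X n` over the past instances.  Ties may be broken in any way. -/
def IsNearestNeighborProcess {Ω 𝒳 : Type*} [MeasurableSpace Ω] [MetricSpace 𝒳]
    (X Xt : ℕ → Ω → 𝒳) (μ : Measure Ω) : Prop :=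
  ∀ᵐ ω ∂μ, ∀ n : ℕ, 1 ≤ n → Xt n ω ∈ pastInstances X n ω ∧
    IsMinOn (fun z => dist (X n ω) z) (pastInstances X n ω) (Xt n ω)

/-- The mistake rate up to time `N`: the average over `n = 1, …, N` of the indicator of
`η (X n) ≠ η (Xt n)`. -/
noncomputable def mistakeRate {Ω 𝒳 𝒴 : Type*} (η : 𝒳 → 𝒴) (X Xt : ℕ → Ω → 𝒳) (N : ℕ) (ω : Ω) : ℝ :=
  (1 / (N : ℝ)) * ∑ n ∈ Finset.Icc 1 N,
    Set.indicator {k : ℕ | η (X k ω) ≠ η (Xt k ω)} (fun _ => (1 : ℝ)) n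

/-- The nearest neighbor rule is online consistent for the process `X` and the label function `η`:
for every nearest neighbor process of `X`, the mistake rate tends to zero almost surely (for this
nonnegative quantity the same as that its upper limit is zero). -/
def NearestNeighborOnlineConsistent {Ω 𝒳 𝒴 : Type*} [MeasurableSpace Ω] [MetricSpace 𝒳]
    (X : ℕ → Ω → 𝒳) (μ : Measure Ω) (η : 𝒳 → 𝒴) : Prop :=
  ∀ Xt : ℕ → Ω → 𝒳, IsNearestNeighborProcess X Xt μ →
    ∀ᵐ ω ∂μ, Tendsto (fun N : ℕ => mistakeRate η X Xt N ω) atTop (𝓝 0)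

/-!
A mistake at time `n` means that `X n` and its nearest neighbour carry different labels. By outer
regularity there is a set `A` of small `ν`-measure off which close points have equal labels
(`exists_measure_lt_forall_dist_lt_eq`), so a mistake forces `X n ∈ A`, or a nearest neighbour in
`A`, or a nearest neighbour that is not close. Uniform domination makes visits of `X` to a set of
small measure rare; this holds for random sets determined by the past, too, and with the set allowed
to depend on the horizon `N`, because the probability that a fixed fraction of `N` events of small
conditional probability occur is exponentially small in `N` (`exists_eventually_countUpTo_le`).

The difficulty is that one point of `A` may be the nearest neighbour of many later points. This is
controlled by scales, for a fixed small `lam > 0` and with `D = 2 ^ d`: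
* Visits outside a sufficiently large ball are rare. Points of that ball whose distance to the past
  exceeds `r` are `r`-separated, so by doubling there are at most about `r ^ (-d)` of them. With `r`
  of order `(lam * N) ^ (-1 / d)` they number at most `lam * N`.
* For a large constant `L`, the balls of radius about `r / 2 ^ L` around the past points have total
  measure at most a constant times `N * r ^ d / D ^ L`, which is small independently of `N`; hence
  points rarely have a nearest neighbour that near.
* Points with the same nearest neighbour at a distance between `r / 2 ^ L` and `r` are separated and
  lie in a common ball, so there are at most `D ^ (L + 3)` of them. As `L` does not depend on `N`,
  the measure of `A` can be chosen after `L`, so that visits to `A` are rare even when multiplied by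
  this constant (`IsDoublingOfDim.countUpTo_neighbor_le`).
Adding up gives a mistake rate of at most `6 * lam`. In dimension `d = 0` there is no decay of the
measure of balls, but then the space has at most one point.
-/

/-! ### Counting times -/

open Classical in
/-- The number of times `1 ≤ n ≤ N` at which `p` holds. -/
noncomputable def countUpTo (p : ℕ → Prop) (N : ℕ) : ℕ := ((Finset.Icc 1 N).filter p).card

lemma countUpTo_eq_card (p : ℕ → Prop) [DecidablePred p] (N : ℕ) :
    countUpTo p N = ((Finset.Icc 1 N).filter p).card := by
  unfold countUpTo
  congr

lemma countUpTo_succ_of_true {p : ℕ → Prop} {N : ℕ} (h : p (N + 1)) :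
    countUpTo p (N + 1) = countUpTo p N + 1 := by
  classical
  unfold countUpTo
  rw [← Finset.insert_Icc_right_eq_Icc_add_one (by omega), Finset.filter_insert, if_pos h,
    Finset.card_insert_of_notMem (by simp)]

lemma countUpTo_succ_of_false {p : ℕ → Prop} {N : ℕ} (h : ¬ p (N + 1)) :
    countUpTo p (N + 1) = countUpTo p N := by
  classical
  unfold countUpTo
  rw [← Finset.insert_Icc_right_eq_Icc_add_one (by omega), Finset.filter_insert, if_neg h]

lemma countUpTo_mono {p q : ℕ → Prop} {N : ℕ} (h : ∀ n, 1 ≤ n → n ≤ N → p n → q n) :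
    countUpTo p N ≤ countUpTo q N := by
  classical
  unfold countUpTo
  refine Finset.card_le_card fun n hn => ?_
  simp only [Finset.mem_filter, Finset.mem_Icc] at hn ⊢
  exact ⟨hn.1, h n hn.1.1 hn.1.2 hn.2⟩

lemma countUpTo_or_le (p q : ℕ → Prop) (N : ℕ) :
    countUpTo (fun n => p n ∨ q n) N ≤ countUpTo p N + countUpTo q N := by
  classical
  unfold countUpTo
  refine (Finset.card_le_card fun n hn => ?_).trans (Finset.card_union_le _ _)
  simp only [Finset.mem_filter, Finset.mem_union] at hn ⊢
  tauto

/-! ### Events of small conditional probability -/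

section Concentration

variable {Ω : Type*}

lemma setOf_le_countUpTo_succ (G : ℕ → Set Ω) (N k : ℕ) :
    {ω | k + 1 ≤ countUpTo (fun n => ω ∈ G n) (N + 1)} =
      {ω | k + 1 ≤ countUpTo (fun n => ω ∈ G n) N} ∪
        (G (N + 1) ∩ {ω | k ≤ countUpTo (fun n => ω ∈ G n) N}) := by
  ext ω
  by_cases h : ω ∈ G (N + 1)
  · simp only [Set.mem_ofPred_eq, Set.mem_union, Set.mem_inter_iff, h, true_and,
      countUpTo_succ_of_true (p := fun n => ω ∈ G n) h]
    omega
  · simp only [Set.mem_ofPred_eq, Set.mem_union, Set.mem_inter_iff, h, false_and, or_false,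
      countUpTo_succ_of_false (p := fun n => ω ∈ G n) h]

lemma measurableSet_le_countUpTo {ℱ : ℕ → MeasurableSpace Ω} (hℱ : Monotone ℱ) {G : ℕ → Set Ω}
    (hG : ∀ n, 1 ≤ n → MeasurableSet[ℱ (n + 1)] (G n)) (N k : ℕ) :
    MeasurableSet[ℱ (N + 1)] {ω | k ≤ countUpTo (fun n => ω ∈ G n) N} := by
  induction N generalizing k with
  | zero => simp [countUpTo]
  | succ N ih =>
    cases k with
    | zero => simp
    | succ k =>
      rw [setOf_le_countUpTo_succ]
      have hle : ℱ (N + 1) ≤ ℱ (N + 1 + 1) := hℱ (by omega)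
      exact (hle _ (ih _)).union ((hG _ (by omega)).inter (hle _ (ih _)))

/-- If, conditionally on the past, each event `G n` has probability at most `ε`, then the
probability that `k` of the first `N` events occur is at most the union bound `(N choose k) ε ^ k`
for independent events of probability `ε`. -/
lemma measure_le_countUpTo_le [MeasurableSpace Ω] (μ : Measure Ω) [IsProbabilityMeasure μ]
    {ℱ : ℕ → MeasurableSpace Ω} (hℱ : Monotone ℱ) {G : ℕ → Set Ω}
    (hG : ∀ n, 1 ≤ n → MeasurableSet[ℱ (n + 1)] (G n)) {ε : ENNReal} {M : ℕ}
    (h : ∀ n, 1 ≤ n → n ≤ M → ∀ E, MeasurableSet[ℱ n] E → μ (G n ∩ E) ≤ ε * μ E)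
    {N : ℕ} (hN : N ≤ M) (k : ℕ) :
    μ {ω | k ≤ countUpTo (fun n => ω ∈ G n) N} ≤ N.choose k * ε ^ k := by
  induction N generalizing k with
  | zero =>
    cases k with
    | zero => simp
    | succ k => simp [countUpTo]
  | succ N ih =>
    cases k with
    | zero => simp
    | succ k =>
      rw [setOf_le_countUpTo_succ]
      calc _ ≤ μ {ω | k + 1 ≤ countUpTo (fun n => ω ∈ G n) N} +
            μ (G (N + 1) ∩ {ω | k ≤ countUpTo (fun n => ω ∈ G n) N}) := measure_union_le _ _
        _ ≤ N.choose (k + 1) * ε ^ (k + 1) + ε * (N.choose k * ε ^ k) := by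
            gcongr
            · exact ih (by omega) _
            · exact (h _ (by omega) hN _ (measurableSet_le_countUpTo hℱ hG _ _)).trans
                (by gcongr; exact ih (by omega) _)
        _ = (N + 1).choose (k + 1) * ε ^ (k + 1) := by
            rw [Nat.choose_succ_succ]; push_cast; ring

/-- A strong law for triangular arrays of events: for each `lam > 0` there is `ε > 0` such that
events of conditional probability at most `ε` eventually have frequency at most `lam`. -/
lemma exists_eventually_countUpTo_le [MeasurableSpace Ω] (μ : Measure Ω) [IsProbabilityMeasure μ]
    {ℱ : ℕ → MeasurableSpace Ω} (hℱ : Monotone ℱ) {lam : ℝ} (hlam : 0 < lam) :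
    ∃ ε : ℝ, 0 < ε ∧ ∀ G : ℕ → ℕ → Set Ω,
      (∀ N n, 1 ≤ n → MeasurableSet[ℱ (n + 1)] (G N n)) →
      (∀ N n, 1 ≤ n → n ≤ N → ∀ E, MeasurableSet[ℱ n] E →
        μ (G N n ∩ E) ≤ ENNReal.ofReal ε * μ E) →
      ∀ᵐ ω ∂μ, ∀ᶠ N in atTop, (countUpTo (fun n => ω ∈ G N n) N : ℝ) ≤ lam * N := by
  -- `ε ^ lam = 1 / 4` beats the `2 ^ N` subsets of times in the union bound.
  refine ⟨(1 / 4 : ℝ) ^ (1 / lam), by positivity, fun G hG h => ?_⟩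
  set ε : ℝ := (1 / 4 : ℝ) ^ (1 / lam) with hε
  have hε0 : 0 < ε := by positivity
  have hε1 : ε ≤ 1 := Real.rpow_le_one (by norm_num) (by norm_num) (by positivity)
  have key : ∀ N : ℕ, μ {ω | ¬ (countUpTo (fun n => ω ∈ G N n) N : ℝ) ≤ lam * N} ≤
      ENNReal.ofReal ((1 / 2) ^ N) := by
    intro N
    have hsub : {ω | ¬ (countUpTo (fun n => ω ∈ G N n) N : ℝ) ≤ lam * N} ⊆
        {ω | ⌊lam * N⌋₊ + 1 ≤ countUpTo (fun n => ω ∈ G N n) N} := by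
      intro ω hω
      simp only [Set.mem_ofPred_eq, not_le] at hω ⊢
      exact (Nat.floor_lt (by positivity)).2 hω
    refine (measure_mono hsub).trans
      ((measure_le_countUpTo_le μ hℱ (hG N) (h N) le_rfl _).trans ?_)
    rw [← ENNReal.ofReal_pow hε0.le, ← ENNReal.ofReal_natCast,
      ← ENNReal.ofReal_mul (by positivity)]
    apply ENNReal.ofReal_le_ofReal
    have h1 : (N.choose (⌊lam * N⌋₊ + 1) : ℝ) ≤ 2 ^ N := by
      exact_mod_cast Nat.choose_le_two_pow _ _
    have h2 : ε ^ (⌊lam * N⌋₊ + 1) ≤ (1 / 4 : ℝ) ^ N := by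
      have h3 : ε ^ ((⌊lam * N⌋₊ + 1 : ℕ) : ℝ) ≤ ε ^ (lam * N) := by
        apply Real.rpow_le_rpow_of_exponent_ge hε0 hε1
        push_cast
        exact (Nat.lt_floor_add_one _).le
      rw [Real.rpow_natCast] at h3
      refine h3.trans (le_of_eq ?_)
      rw [hε, ← Real.rpow_mul (by norm_num), ← mul_assoc, one_div_mul_cancel hlam.ne', one_mul,
        Real.rpow_natCast]
    calc _ ≤ (2 : ℝ) ^ N * (1 / 4) ^ N := by gcongr
      _ = (1 / 2) ^ N := by rw [← mul_pow]; norm_num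
  have hsum : ∑' N : ℕ, μ {ω | ¬ (countUpTo (fun n => ω ∈ G N n) N : ℝ) ≤ lam * N} ≠ ⊤ := by
    refine ne_top_of_le_ne_top ?_ (ENNReal.tsum_le_tsum key)
    exact (summable_geometric_two).tsum_ofReal_ne_top
  filter_upwards [ae_eventually_notMem hsum] with ω hω
  filter_upwards [hω] with N hN
  simpa using hN

end Concentration

/-! ### Visits to predictable sets of small measure -/

section Domination

lemma pastSigma_mono {Ω 𝒳 : Type*} [MeasurableSpace 𝒳] (X : ℕ → Ω → 𝒳) :
    Monotone (pastSigma X) := fun _ _ h =>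
      iSup_mono fun _ => iSup_le fun hm => le_iSup_of_le (lt_of_lt_of_le hm h) le_rfl

lemma measurable_pastSigma {Ω 𝒳 : Type*} [MeasurableSpace 𝒳] (X : ℕ → Ω → 𝒳) {m n : ℕ}
    (h : m < n) :
    Measurable[pastSigma X n] (X m) := by
  refine measurable_iff_comap_le.2 ?_
  exact le_iSup₂_of_le (f := fun m (_ : m < n) => MeasurableSpace.comap (X m) inferInstance)
    m h le_rfl

variable {Ω 𝒳 : Type*} [MeasurableSpace Ω] [MeasurableSpace 𝒳]

lemma pastSigma_le {X : ℕ → Ω → 𝒳} (hX : ∀ n, Measurable (X n)) (n : ℕ) :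
    pastSigma X n ≤ ‹MeasurableSpace Ω› := iSup₂_le fun m _ => (hX m).comap_le

lemma IsUniformlyDominated.exists_measure_inter_le {X : ℕ → Ω → 𝒳} {μ : Measure Ω}
    [IsProbabilityMeasure μ] {ν : Measure 𝒳} (hdom : IsUniformlyDominated X μ ν)
    (hX : ∀ n, Measurable (X n)) {ε : ℝ} (hε : 0 < ε) :
    ∃ δ : ℝ, 0 < δ ∧ ∀ A : Set 𝒳, MeasurableSet A → ν A < ENNReal.ofReal δ → ∀ n, 1 ≤ n →
      ∀ E, MeasurableSet[pastSigma X n] E → μ (X n ⁻¹' A ∩ E) ≤ ENNReal.ofReal ε * μ E := by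
  obtain ⟨δ, hδ, h⟩ := hdom ε hε
  refine ⟨δ, hδ, fun A hA hνA n hn E hE => ?_⟩
  have hle := pastSigma_le hX n
  have hmeas : MeasurableSet (X n ⁻¹' A) := hX n hA
  have hae : ∀ᵐ ω ∂μ, (μ⟦X n ⁻¹' A | pastSigma X n⟧) ω ≤ ε := by
    filter_upwards [h A hA hνA] with ω hω
    have h2 := (le_iSup₂ (f := fun (n : ℕ) (_ : 1 ≤ n) =>
      (((μ⟦X n ⁻¹' A | pastSigma X n⟧) ω : ℝ) : EReal)) n hn).trans hω.le
    exact_mod_cast h2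
  have h1 : ∫ ω in E, (μ⟦X n ⁻¹' A | pastSigma X n⟧) ω ∂μ = μ.real (X n ⁻¹' A ∩ E) := by
    rw [setIntegral_condExp hle ((integrable_const (1 : ℝ)).indicator hmeas) hE,
      integral_indicator_const _ hmeas, measureReal_restrict_apply hmeas]
    simp
  have h2 : μ.real (X n ⁻¹' A ∩ E) ≤ ε * μ.real E := by
    rw [← h1]
    calc _ ≤ ∫ _ in E, ε ∂μ :=
          setIntegral_mono_ae integrable_condExp.integrableOn (integrable_const ε).integrableOn hae
      _ = ε * μ.real E := by simp [mul_comm]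
  rw [← ofReal_measureReal, ← ofReal_measureReal, ← ENNReal.ofReal_mul hε.le]
  exact ENNReal.ofReal_le_ofReal h2

/-- Frequencies of visits to small predictable random sets. The random set at time `n` is `S N n t`,
where the index `t = T N n ω` is known at time `n` and takes countably many values, so that the
domination hypothesis, which concerns fixed sets, applies on each event `T N n = t`. -/
lemma IsUniformlyDominated.exists_eventually_countUpTo_le {X : ℕ → Ω → 𝒳} {μ : Measure Ω}
    [IsProbabilityMeasure μ] {ν : Measure 𝒳} (hdom : IsUniformlyDominated X μ ν)
    (hX : ∀ n, Measurable (X n)) {lam : ℝ} (hlam : 0 < lam) :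
    ∃ δ : ℝ, 0 < δ ∧ ∀ (ι : ℕ → Type) [∀ n, Countable (ι n)] [∀ n, MeasurableSpace (ι n)]
      [∀ n, MeasurableSingletonClass (ι n)] (T : ∀ _ n : ℕ, Ω → ι n)
      (_ : ∀ N n, Measurable[pastSigma X n] (T N n)) (S : ∀ _ n : ℕ, ι n → Set 𝒳)
      (_ : ∀ N n t, MeasurableSet (S N n t))
      (_ : ∀ N n t, n ≤ N → ν (S N n t) < ENNReal.ofReal δ),
      ∀ᵐ ω ∂μ, ∀ᶠ N in atTop,
        (countUpTo (fun n => X n ω ∈ S N n (T N n ω)) N : ℝ) ≤ lam * N := by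
  obtain ⟨ε, hε, hcount⟩ := _root_.exists_eventually_countUpTo_le μ (pastSigma_mono X) hlam
  obtain ⟨δ, hδ, h⟩ := hdom.exists_measure_inter_le hX hε
  refine ⟨δ, hδ, fun ι _ _ _ T hT S hS hν => ?_⟩
  have hdecomp : ∀ N n, {ω | X n ω ∈ S N n (T N n ω)} =
      ⋃ t, X n ⁻¹' S N n t ∩ T N n ⁻¹' {t} := by
    intro N n; ext ω; simp
  refine hcount (fun N n => {ω | X n ω ∈ S N n (T N n ω)}) ?_ ?_
  · intro N n _
    rw [hdecomp]
    refine MeasurableSet.iUnion fun t => ?_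
    exact (measurable_pastSigma X (Nat.lt_succ_self n) (hS N n t)).inter
      (pastSigma_mono X (Nat.le_succ n) _ (hT N n (measurableSet_singleton t)))
  · intro N n hn hnN E hE
    have hle := pastSigma_le hX n
    have hpre : ∀ t, MeasurableSet[pastSigma X n] (T N n ⁻¹' {t} ∩ E) := fun t =>
      (hT N n (measurableSet_singleton t)).inter hE
    rw [hdecomp, Set.iUnion_inter]
    calc _ ≤ ∑' t, μ (X n ⁻¹' S N n t ∩ T N n ⁻¹' {t} ∩ E) := measure_iUnion_le _
      _ ≤ ∑' t, ENNReal.ofReal ε * μ (T N n ⁻¹' {t} ∩ E) := by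
          refine ENNReal.tsum_le_tsum fun t => ?_
          rw [Set.inter_assoc]
          exact h _ (hS N n t) (hν N n t hnN) n hn _ (hpre t)
      _ = ENNReal.ofReal ε * μ E := by
          rw [ENNReal.tsum_mul_left, ← measure_iUnion _ fun t => hle _ (hpre t),
            ← Set.iUnion_inter, ← Set.preimage_iUnion, Set.iUnion_of_singleton, Set.preimage_univ,
            Set.univ_inter]
          · intro s t hst
            refine Set.disjoint_left.2 fun ω h1 h2 => hst ?_
            exact h1.1.symm.trans h2.1

end Domination

/-! ### Covering and separation in doubling spaces -/

/-- Open covering balls of any radius above `r / 2 ^ k` leave room to iterate the doubling property,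
whose covering balls are closed. -/
lemma IsDoublingOfDim.exists_cover {𝒳 : Type*} [MetricSpace 𝒳] {d : ℝ} (h : IsDoublingOfDim 𝒳 d)
    (k : ℕ) (x : 𝒳) {r r' : ℝ} (hr : 0 < r) (hr' : r / 2 ^ k < r') :
    ∃ s : Finset 𝒳, (s.card : ℝ) ≤ ((2 : ℝ) ^ d) ^ k ∧
      Metric.ball x r ⊆ ⋃ y ∈ s, Metric.ball y r' := by
  classical
  induction k generalizing x r with
  | zero =>
    refine ⟨{x}, by simp, ?_⟩
    simp only [pow_zero, div_one] at hr'
    simpa using Metric.ball_subset_ball hr'.le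
  | succ k ih =>
    obtain ⟨s, hs, hcov⟩ := h x r hr
    have hlt : r / 2 < r' * 2 ^ k := by
      rw [div_lt_iff₀ (by positivity)] at hr' ⊢
      rw [pow_succ] at hr'; linarith
    obtain ⟨ρ, hρ1, hρ2⟩ := exists_between hlt
    have hρ0 : 0 < ρ := (half_pos hr).trans hρ1
    choose t ht htcov using fun y => ih y hρ0 ((div_lt_iff₀ (by positivity)).2 hρ2)
    refine ⟨s.biUnion t, ?_, ?_⟩
    · calc ((s.biUnion t).card : ℝ) ≤ ∑ y ∈ s, ((t y).card : ℝ) := by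
            exact_mod_cast Finset.card_biUnion_le
        _ ≤ ∑ y ∈ s, ((2 : ℝ) ^ d) ^ k := Finset.sum_le_sum fun y _ => ht y
        _ = s.card * ((2 : ℝ) ^ d) ^ k := by simp
        _ ≤ (2 : ℝ) ^ d * ((2 : ℝ) ^ d) ^ k := by gcongr
        _ = _ := by ring
    · intro z hz
      obtain ⟨y, hy, hzy⟩ := Set.mem_iUnion₂.1 (hcov hz)
      obtain ⟨w, hw, hzw⟩ := Set.mem_iUnion₂.1
        (htcov y (Metric.closedBall_subset_ball hρ1 hzy))
      exact Set.mem_iUnion₂.2 ⟨w, Finset.mem_biUnion.2 ⟨y, hy, hw⟩, hzw⟩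

lemma IsDoublingOfDim.subsingleton {𝒳 : Type*} [MetricSpace 𝒳] (h : IsDoublingOfDim 𝒳 0) :
    Subsingleton 𝒳 := by
  refine ⟨fun x y => ?_⟩
  by_contra hne
  have hpos : 0 < dist x y := dist_pos.2 hne
  obtain ⟨s, hs, hcov⟩ := h.exists_cover 3 x (r := 2 * dist x y) (r' := dist x y / 2)
    (by positivity) (by linarith)
  have hs1 : s.card ≤ 1 := by simpa using hs
  obtain ⟨z, hz, hxz⟩ := Set.mem_iUnion₂.1 (hcov (Metric.mem_ball_self (by positivity)))
  obtain ⟨w, hw, hyw⟩ := Set.mem_iUnion₂.1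
    (hcov (show y ∈ Metric.ball x (2 * dist x y) by
      rw [Metric.mem_ball, dist_comm]; linarith))
  obtain rfl := Finset.card_le_one.1 hs1 z hz w hw
  have := dist_triangle_right x y z
  rw [Metric.mem_ball] at hxz hyw
  linarith

/-- Points of a sequence that lie in a common ball, each at distance more than `ρ` from its
predecessors, are `ρ`-separated; hence there are at most as many as balls of radius `ρ / 2` in a
cover. -/
lemma IsDoublingOfDim.card_le_of_separated {𝒳 : Type*} [MetricSpace 𝒳] {d : ℝ}
    (h : IsDoublingOfDim 𝒳 d) {x : ℕ → 𝒳} {I : Finset ℕ} {z : 𝒳} {R ρ : ℝ} {k : ℕ}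
    (hR : 0 < R) (hk : R / 2 ^ k < ρ / 2) (hI : ∀ n ∈ I, x n ∈ Metric.ball z R)
    (hsep : ∀ n ∈ I, ∀ m < n, ρ < dist (x n) (x m)) :
    (I.card : ℝ) ≤ ((2 : ℝ) ^ d) ^ k := by
  obtain ⟨s, hs, hcov⟩ := h.exists_cover k z hR hk
  refine le_trans ?_ hs
  have hex : ∀ n ∈ I, ∃ y ∈ s, x n ∈ Metric.ball y (ρ / 2) := fun n hn => by
    simpa using hcov (hI n hn)
  have : Nonempty 𝒳 := ⟨z⟩
  choose! f hf hxf using hex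
  have hlt : ∀ m ∈ I, ∀ n ∈ I, m < n → f m ≠ f n := fun m hm n hn hmn heq => by
    have h1 := hxf m hm
    have h2 := hxf n hn
    rw [Metric.mem_ball] at h1 h2
    rw [heq] at h1
    have := dist_triangle_right (x n) (x m) (f n)
    linarith [hsep n hn m hmn]
  exact_mod_cast Finset.card_le_card_of_injOn f hf fun m hm n hn heq => by
    rcases lt_trichotomy m n with hmn | hmn | hmn
    · exact absurd heq (hlt m hm n hn hmn)
    · exact hmn
    · exact absurd heq.symm (hlt n hn m hm hmn)

/-! ### Approximation of labels and localization -/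

/-- A quantitative Lusin property: off a set of small measure, the labels of close points agree. -/
lemma exists_measure_lt_forall_dist_lt_eq {𝒳 𝒴 : Type*} [MetricSpace 𝒳] [MeasurableSpace 𝒳]
    [BorelSpace 𝒳] (ν : Measure 𝒳) [IsFiniteMeasure ν] [Countable 𝒴] [MeasurableSpace 𝒴]
    [MeasurableSingletonClass 𝒴] {η : 𝒳 → 𝒴} (hη : Measurable η) {δ : ENNReal} (hδ : 0 < δ) :
    ∃ A, MeasurableSet A ∧ ν A < δ ∧ ∃ r : ℝ, 0 < r ∧
      ∀ x ∉ A, ∀ y ∉ A, dist x y < r → η x = η y := by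
  have hδ2 : δ / 2 ≠ 0 := (ENNReal.half_pos hδ.ne').ne'
  obtain ⟨e, he0, hesum⟩ := ENNReal.exists_pos_sum_of_countable' hδ2 𝒴
  have hfib : ∀ y, MeasurableSet (η ⁻¹' {y}) := fun y => hη (measurableSet_singleton y)
  choose U hUsub hUopen hUfin hUdiff using fun y =>
    (hfib y).exists_isOpen_sdiff_lt (measure_ne_top ν _) (he0 y).ne'
  -- Points that an open neighbourhood of another fibre has wrongly captured.
  set B : Set 𝒳 := ⋃ y, U y \ η ⁻¹' {y} with hB
  have hBm : MeasurableSet B := MeasurableSet.iUnion fun y => (hUopen y).measurableSet.diff (hfib y)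
  have hBν : ν B < δ / 2 :=
    ((measure_iUnion_le _).trans (ENNReal.tsum_le_tsum fun y => (hUdiff y).le)).trans_lt hesum
  -- Points too close to the boundary of the open neighbourhood of their own fibre.
  set C : ℕ → Set 𝒳 := fun n =>
    ⋃ y, η ⁻¹' {y} ∩ Metric.thickening (1 / ((n : ℝ) + 1)) (U y)ᶜ with hC
  have hCm : ∀ n, MeasurableSet (C n) := fun n => MeasurableSet.iUnion fun y =>
    (hfib y).inter Metric.isOpen_thickening.measurableSet
  have hCanti : Antitone C := fun m n hmn => Set.iUnion_mono fun y =>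
    Set.inter_subset_inter_right _
      (Metric.thickening_mono (one_div_le_one_div_of_le (by positivity) (by gcongr)) _)
  have hCempty : ⋂ n, C n = ∅ := by
    refine Set.eq_empty_of_forall_notMem fun x hx => ?_
    have hxU : x ∈ U (η x) := hUsub (η x) rfl
    obtain ⟨ρ, hρ, hball⟩ := Metric.isOpen_iff.1 (hUopen (η x)) x hxU
    obtain ⟨n, hn⟩ := exists_nat_one_div_lt hρ
    obtain ⟨y, hy, hxy⟩ := Set.mem_iUnion.1 (Set.mem_iInter.1 hx n)
    obtain rfl : η x = y := hy
    obtain ⟨z, hz, hxz⟩ := Metric.mem_thickening_iff.1 hxy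
    exact hz (hball (by rw [Metric.mem_ball, dist_comm]; exact hxz.trans hn))
  have hCtend : Tendsto (fun n => ν (C n)) atTop (𝓝 0) := by
    have := tendsto_measure_iInter_atTop (μ := ν) (fun n => (hCm n).nullMeasurableSet) hCanti
      ⟨0, measure_ne_top ν _⟩
    rwa [hCempty, measure_empty] at this
  obtain ⟨n, hn⟩ := (hCtend.eventually_lt_const (pos_iff_ne_zero.2 hδ2)).exists
  refine ⟨B ∪ C n, hBm.union (hCm n), ?_, 1 / ((n : ℝ) + 1), by positivity, ?_⟩
  · calc ν (B ∪ C n) ≤ ν B + ν (C n) := measure_union_le _ _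
      _ < δ / 2 + δ / 2 := ENNReal.add_lt_add hBν hn
      _ = δ := ENNReal.add_halves δ
  · intro x hx y hy hxy
    have hyU : y ∈ U (η x) := by
      by_contra hyU
      refine hx (Or.inr (Set.mem_iUnion.2 ⟨η x, rfl, ?_⟩))
      exact Metric.mem_thickening_iff.2 ⟨y, hyU, hxy⟩
    by_contra hne
    exact hy (Or.inl (Set.mem_iUnion.2 ⟨η x, hyU, fun h => hne h.symm⟩))

lemma exists_measure_compl_ball_lt {𝒳 : Type*} [MetricSpace 𝒳] [MeasurableSpace 𝒳]
    [BorelSpace 𝒳] (ν : Measure 𝒳) [IsFiniteMeasure ν] (x : 𝒳) {δ : ENNReal} (hδ : 0 < δ) :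
    ∃ R : ℝ, 0 < R ∧ ν (Metric.ball x R)ᶜ < δ := by
  have hanti : Antitone fun n : ℕ => (Metric.ball x (n : ℝ))ᶜ := fun m n hmn =>
    Set.compl_subset_compl.2 (Metric.ball_subset_ball (by exact_mod_cast hmn))
  have hempty : ⋂ n : ℕ, (Metric.ball x (n : ℝ))ᶜ = ∅ := by
    rw [← Set.compl_iUnion, Metric.iUnion_ball_nat, Set.compl_univ]
  have htend := tendsto_measure_iInter_atTop (μ := ν)
    (fun n => (Metric.isOpen_ball.measurableSet.compl : MeasurableSet _).nullMeasurableSet) hanti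
    ⟨0, measure_ne_top ν _⟩
  rw [hempty, measure_empty] at htend
  obtain ⟨n, hn, hn1⟩ := ((htend.eventually_lt_const hδ).and (eventually_ge_atTop 1)).exists
  exact ⟨n, by exact_mod_cast hn1, hn⟩

/-! ### Nearest neighbour distances -/

section Counting

variable {𝒳 : Type*} [MetricSpace 𝒳] {d : ℝ} {x xt : ℕ → 𝒳}

lemma IsDoublingOfDim.countUpTo_far_le (h : IsDoublingOfDim 𝒳 d)
    (hmin : ∀ n, 1 ≤ n → ∀ m < n, dist (x n) (xt n) ≤ dist (x n) (x m)) {z : 𝒳} {R ρ : ℝ} {k : ℕ}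
    (hR : 0 < R) (hk : R / 2 ^ k < ρ / 2) (N : ℕ) :
    (countUpTo (fun n => x n ∈ Metric.ball z R ∧ ρ < dist (x n) (xt n)) N : ℝ) ≤
      ((2 : ℝ) ^ d) ^ k := by
  classical
  rw [countUpTo_eq_card]
  refine h.card_le_of_separated (x := x) (z := z) hR hk (fun n hn => ?_) fun n hn m hmn => ?_
  · exact (Finset.mem_filter.1 hn).2.1
  · obtain ⟨h1, h2⟩ := Finset.mem_filter.1 hn
    exact h2.2.trans_le (hmin n (Finset.mem_Icc.1 h1).1 m hmn)

/-- Within a fixed range of scales, a point can be the nearest neighbour of boundedly many later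
points; hence nearest neighbours fall into `A` at most boundedly more often than the points of the
sequence do. The summand `1` accounts for the initial point. -/
lemma IsDoublingOfDim.countUpTo_neighbor_le (h : IsDoublingOfDim 𝒳 d)
    (hmem : ∀ n, 1 ≤ n → ∃ m < n, x m = xt n)
    (hmin : ∀ n, 1 ≤ n → ∀ m < n, dist (x n) (xt n) ≤ dist (x n) (x m)) (A : Set 𝒳) {ρ ρ' : ℝ}
    {k : ℕ} (hρ : 0 < ρ) (hk : 2 * ρ / 2 ^ k < ρ' / 2) (N : ℕ) :
    (countUpTo (fun n => xt n ∈ A ∧ ρ' < dist (x n) (xt n) ∧ dist (x n) (xt n) ≤ ρ) N : ℝ) ≤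
      ((2 : ℝ) ^ d) ^ k * (1 + countUpTo (fun n => x n ∈ A) N) := by
  classical
  rw [countUpTo_eq_card, countUpTo_eq_card]
  choose! f hflt hf using hmem
  set I := (Finset.Icc 1 N).filter
    (fun n => xt n ∈ A ∧ ρ' < dist (x n) (xt n) ∧ dist (x n) (xt n) ≤ ρ) with hI
  set J := (Finset.Icc 1 N).filter (fun n => x n ∈ A) with hJ
  have hIJ : Set.MapsTo f (I : Set ℕ) (insert 0 J : Finset ℕ) := by
    intro n hn
    obtain ⟨h1, h2, -⟩ := Finset.mem_filter.1 (Finset.mem_coe.1 hn)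
    rw [Finset.mem_Icc] at h1
    rw [Finset.mem_coe, Finset.mem_insert, hJ, Finset.mem_filter, Finset.mem_Icc, hf n h1.1]
    have := hflt n h1.1
    rcases Nat.eq_zero_or_pos (f n) with h0 | h0
    · exact Or.inl h0
    · exact Or.inr ⟨⟨h0, by omega⟩, h2⟩
  have hfiber : ∀ m, (((I.filter fun n => f n = m).card : ℕ) : ℝ) ≤ ((2 : ℝ) ^ d) ^ k := by
    intro m
    refine h.card_le_of_separated (x := x) (z := x m) (R := 2 * ρ) (by positivity) hk
      (fun n hn => ?_) fun n hn l hln => ?_ <;>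
      obtain ⟨h1, rfl⟩ := Finset.mem_filter.1 hn <;>
      obtain ⟨h2, -, h3, h4⟩ := Finset.mem_filter.1 h1 <;>
      rw [Finset.mem_Icc] at h2
    · rw [Metric.mem_ball, hf n h2.1]
      linarith
    · exact h3.trans_le (hmin n h2.1 l hln)
  calc (I.card : ℝ) = ∑ m ∈ insert 0 J, (((I.filter fun n => f n = m).card : ℕ) : ℝ) := by
        exact_mod_cast Finset.card_eq_sum_card_fiberwise hIJ
    _ ≤ ∑ m ∈ insert 0 J, ((2 : ℝ) ^ d) ^ k := Finset.sum_le_sum fun m _ => hfiber m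
    _ = ((2 : ℝ) ^ d) ^ k * ((insert 0 J).card : ℕ) := by simp [mul_comm]
    _ ≤ ((2 : ℝ) ^ d) ^ k * (1 + J.card) := by
        gcongr
        have := Finset.card_insert_le 0 J
        rw [add_comm]
        exact_mod_cast this

end Counting

/-! ### Visits to a set and returns near the past -/

section Frequencies

variable {Ω 𝒳 : Type*} [MeasurableSpace Ω] {X : ℕ → Ω → 𝒳} {μ : Measure Ω}
  [IsProbabilityMeasure μ]

lemma IsUniformlyDominated.exists_eventually_countUpTo_mem_le [MeasurableSpace 𝒳] {ν : Measure 𝒳}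
    (hdom : IsUniformlyDominated X μ ν) (hX : ∀ n, Measurable (X n)) {lam : ℝ} (hlam : 0 < lam) :
    ∃ δ : ℝ, 0 < δ ∧ ∀ A : Set 𝒳, MeasurableSet A → ν A < ENNReal.ofReal δ →
      ∀ᵐ ω ∂μ, ∀ᶠ N in atTop, (countUpTo (fun n => X n ω ∈ A) N : ℝ) ≤ lam * N := by
  obtain ⟨δ, hδ, h⟩ := hdom.exists_eventually_countUpTo_le hX hlam
  exact ⟨δ, hδ, fun A hA hνA => h (fun _ => Unit) (fun _ _ _ => ()) (fun _ _ => measurable_const)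
    (fun _ _ _ => A) (fun _ _ _ => hA) fun _ _ _ _ => hνA⟩

/-- If `N` balls of radius `2 * s N` have small total measure, then points rarely come within
`s N` of the past. The past enters through the indices of the members of a dense sequence that
approximate it, of which there are countably many. -/
lemma IsUniformlyDominated.exists_eventually_countUpTo_near_le [MetricSpace 𝒳]
    [TopologicalSpace.SeparableSpace 𝒳] [Nonempty 𝒳] [MeasurableSpace 𝒳] [BorelSpace 𝒳]
    {ν : Measure 𝒳} (hdom : IsUniformlyDominated X μ ν) (hX : ∀ n, Measurable (X n))
    {lam : ℝ} (hlam : 0 < lam) :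
    ∃ δ : ℝ, 0 < δ ∧ ∀ s : ℕ → ℝ, (∀ N, 0 < s N) →
      (∀ N n : ℕ, n ≤ N → ∀ y : Fin n → 𝒳,
        ∑ m, ν (Metric.ball (y m) (2 * s N)) < ENNReal.ofReal δ) →
      ∀ᵐ ω ∂μ, ∀ᶠ N in atTop,
        (countUpTo (fun n => ∃ m < n, dist (X n ω) (X m ω) ≤ s N) N : ℝ) ≤ lam * N := by
  classical
  obtain ⟨δ, hδ, h⟩ := hdom.exists_eventually_countUpTo_le hX hlam
  refine ⟨δ, hδ, fun s hs hsum => ?_⟩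
  set q := TopologicalSpace.denseSeq 𝒳 with hq
  have hex : ∀ N x, ∃ i, dist x (q i) < s N := fun N x =>
    (TopologicalSpace.denseRange_denseSeq 𝒳).exists_dist_lt x (hs N)
  set idx : ℕ → 𝒳 → ℕ := fun N x => Nat.find (hex N x) with hidx
  have hidx_lt : ∀ N x, dist x (q (idx N x)) < s N := fun N x => Nat.find_spec (hex N x)
  have hidx_meas : ∀ N, Measurable (idx N) := fun N => measurable_find _ fun i =>
    (Metric.isOpen_ball (x := q i) (ε := s N)).measurableSet
  have hae := h (fun n => Fin n → ℕ) (fun N n ω m => idx N (X m ω))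
    (fun N n => @measurable_pi_lambda _ _ _ (pastSigma X n) _ _ fun m =>
      (hidx_meas N).comp (measurable_pastSigma X m.2))
    (fun N n t => ⋃ m, Metric.ball (q (t m)) (2 * s N))
    (fun N n t => MeasurableSet.iUnion fun m => Metric.isOpen_ball.measurableSet)
    (fun N n t hn => (measure_iUnion_fintype_le _ _).trans_lt (hsum N n hn _))
  filter_upwards [hae] with ω hω
  filter_upwards [hω] with N hN
  refine le_trans ?_ hN
  refine Nat.cast_le.2 (countUpTo_mono fun n _ _ ⟨m, hm, hdist⟩ => ?_)
  refine Set.mem_iUnion.2 ⟨⟨m, hm⟩, ?_⟩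
  rw [Metric.mem_ball]
  have := dist_triangle (X n ω) (X m ω) (q (idx N (X m ω)))
  linarith [hidx_lt N (X m ω)]

end Frequencies

/-! ### Consistency -/

lemma mistakeRate_eq {Ω 𝒳 𝒴 : Type*} (η : 𝒳 → 𝒴) (X Xt : ℕ → Ω → 𝒳) (N : ℕ) (ω : Ω) :
    mistakeRate η X Xt N ω = 1 / (N : ℝ) * countUpTo (fun n => η (X n ω) ≠ η (Xt n ω)) N := by
  classical
  rw [mistakeRate, countUpTo_eq_card, Finset.card_filter]
  push_cast
  simp only [Set.indicator_apply, Set.mem_ofPred_eq]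

/-- The scales for the nearest neighbour distance. At time `N` the large scale is
`4 * R / 2 ^ κ N`, with `(2 ^ d) ^ κ N` about `lam * N`; the small scale is smaller by the fixed
factor `2 ^ L`, which makes the total measure of `N` balls of that size small. -/
lemma exists_scales {𝒳 : Type*} [MetricSpace 𝒳] [MeasurableSpace 𝒳] {ν : Measure 𝒳} {d c : ℝ}
    (hd : 0 < d) (hc : 0 < c)
    (hν : ∀ (x : 𝒳) (r : ℝ), 0 < r → ν (Metric.ball x r) ≤ ENNReal.ofReal (c * r ^ d))
    {lam : ℝ} (hlam : 0 < lam) {R : ℝ} (hR : 0 < R) {δ : ℝ} (hδ : 0 < δ) :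
    ∃ (κ : ℕ → ℕ) (L : ℕ), (∀ᶠ N : ℕ in atTop, ((2 : ℝ) ^ d) ^ κ N ≤ lam * N) ∧
      Tendsto κ atTop atTop ∧ ∀ N n : ℕ, n ≤ N → ∀ y : Fin n → 𝒳,
        ∑ m, ν (Metric.ball (y m) (2 * (4 * R / 2 ^ κ N / 2 ^ L))) < ENNReal.ofReal δ := by
  set D : ℝ := 2 ^ d with hD
  have hD1 : 1 < D := Real.one_lt_rpow (by norm_num) hd
  have hD0 : 0 < D := by positivity
  -- For `lam * N < 1` only the upper bound can be met, and the measure estimate needs no more.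
  have hκ : ∀ N : ℕ, ∃ k : ℕ, (1 ≤ lam * N → D ^ k ≤ lam * N) ∧ lam * N < D ^ (k + 1) := by
    intro N
    by_cases h : 1 ≤ lam * N
    · obtain ⟨k, h1, h2⟩ := exists_nat_pow_near h hD1
      exact ⟨k, fun _ => h1, h2⟩
    · exact ⟨0, fun h' => absurd h' h, by rw [zero_add, pow_one]; linarith⟩
  choose κ hκ1 hκ2 using hκ
  obtain ⟨L, hL⟩ := pow_unbounded_of_one_lt (c * (8 * R) ^ d * D / lam / δ) hD1
  have htend : Tendsto (fun N : ℕ => lam * (N : ℝ)) atTop atTop :=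
    tendsto_natCast_atTop_atTop.const_mul_atTop hlam
  refine ⟨κ, L, (htend.eventually_ge_atTop 1).mono hκ1, ?_, fun N n hn y => ?_⟩
  · refine tendsto_atTop.2 fun K => ?_
    filter_upwards [htend.eventually_ge_atTop (D ^ K)] with N hN
    exact Nat.lt_succ_iff.1 ((pow_lt_pow_iff_right₀ hD1).1 (hN.trans_lt (hκ2 N)))
  · have hpow : ∀ k : ℕ, ((2 : ℝ) ^ k) ^ d = D ^ k := fun k => by
      rw [hD, ← Real.rpow_natCast, ← Real.rpow_natCast, ← Real.rpow_mul (by norm_num),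
        ← Real.rpow_mul (by norm_num), mul_comm]
    have hs : (2 * (4 * R / 2 ^ κ N / 2 ^ L) : ℝ) ^ d = (8 * R) ^ d / (D ^ κ N * D ^ L) := by
      rw [show (2 * (4 * R / 2 ^ κ N / 2 ^ L) : ℝ) = 8 * R / (2 ^ κ N * 2 ^ L) by
        field_simp; ring, Real.div_rpow (by positivity) (by positivity),
        Real.mul_rpow (x := 2 ^ κ N) (by positivity) (by positivity), hpow, hpow]
    have hN : (N : ℝ) < D ^ κ N * D / lam := by
      rw [lt_div_iff₀ hlam, mul_comm, ← pow_succ]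
      exact hκ2 N
    calc _ ≤ ∑ _m : Fin n, ENNReal.ofReal (c * ((8 * R) ^ d / (D ^ κ N * D ^ L))) :=
          Finset.sum_le_sum fun m _ => hs ▸ hν _ _ (by positivity)
      _ = ENNReal.ofReal (n * (c * ((8 * R) ^ d / (D ^ κ N * D ^ L)))) := by
          rw [ENNReal.ofReal_mul (Nat.cast_nonneg n)]; simp
      _ < ENNReal.ofReal δ := by
          refine (ENNReal.ofReal_lt_ofReal_iff hδ).2 ?_
          calc (n : ℝ) * (c * ((8 * R) ^ d / (D ^ κ N * D ^ L)))
              ≤ (D ^ κ N * D / lam) * (c * ((8 * R) ^ d / (D ^ κ N * D ^ L))) := by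
                gcongr
                exact (Nat.cast_le.2 hn).trans hN.le
            _ = c * (8 * R) ^ d * D / lam / D ^ L := by field_simp
            _ < δ := by
                rw [div_lt_iff₀ hδ] at hL
                rw [div_lt_iff₀ (by positivity)]
                linarith

/-- The core estimate. Each mistake is charged to one of five events, all of them rare: the instance
lies outside a large ball; it lies inside with its nearest neighbour beyond the large scale; it
comes within the small scale of the past; its nearest neighbour lies in the exceptional set `A` at a
distance between the two scales; or the instance itself lies in `A`. -/
lemma eventually_countUpTo_mistake_le {Ω 𝒳 𝒴 : Type*} [MeasurableSpace Ω] {μ : Measure Ω}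
    [IsProbabilityMeasure μ] [MetricSpace 𝒳] [TopologicalSpace.SeparableSpace 𝒳] [Nonempty 𝒳]
    [MeasurableSpace 𝒳] [BorelSpace 𝒳] {ν : Measure 𝒳} [IsFiniteMeasure ν] {d c : ℝ} (hd : 0 < d)
    (hdoub : IsDoublingOfDim 𝒳 d) (hc : 0 < c)
    (hν : ∀ (x : 𝒳) (r : ℝ), 0 < r → ν (Metric.ball x r) ≤ ENNReal.ofReal (c * r ^ d))
    [Countable 𝒴] [MeasurableSpace 𝒴] [MeasurableSingletonClass 𝒴]
    {X Xt : ℕ → Ω → 𝒳} (hX : ∀ n, Measurable (X n)) (hdom : IsUniformlyDominated X μ ν)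
    {η : 𝒳 → 𝒴} (hη : Measurable η) (hXt : IsNearestNeighborProcess X Xt μ)
    {lam : ℝ} (hlam : 0 < lam) :
    ∀ᵐ ω ∂μ, ∀ᶠ N in atTop,
      (countUpTo (fun n => η (X n ω) ≠ η (Xt n ω)) N : ℝ) ≤ 6 * lam * N := by
  obtain ⟨z⟩ := ‹Nonempty 𝒳›
  have : Nonempty 𝒳 := ⟨z⟩
  have hD0 : (0 : ℝ) < (2 : ℝ) ^ d := by positivity
  -- The ball radius `R` determines `L`, hence `C`; only then is `A` chosen, so small that visits to
  -- it remain rare after multiplication by `C`.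
  obtain ⟨δ₁, hδ₁, hball⟩ := hdom.exists_eventually_countUpTo_mem_le hX hlam
  obtain ⟨R, hR, hνR⟩ := exists_measure_compl_ball_lt ν z (ENNReal.ofReal_pos.2 hδ₁)
  obtain ⟨δ₂, hδ₂, hnear⟩ := hdom.exists_eventually_countUpTo_near_le hX hlam
  obtain ⟨κ, L, hκ, hκtend, hsum⟩ := exists_scales hd hc hν hlam hR hδ₂
  set C : ℝ := ((2 : ℝ) ^ d) ^ (L + 3) with hC
  have hC0 : 0 < C := by positivity
  obtain ⟨δ₃, hδ₃, hexc⟩ := hdom.exists_eventually_countUpTo_mem_le hX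
    (lam := min lam (lam / C)) (by positivity)
  obtain ⟨A, hA, hνA, r₀, hr₀, hlip⟩ :=
    exists_measure_lt_forall_dist_lt_eq ν hη (ENNReal.ofReal_pos.2 hδ₃)
  have hr : ∀ᶠ N in atTop, 4 * R / 2 ^ κ N < r₀ := by
    have h1 : Tendsto (fun k : ℕ => 4 * R * (1 / 2 : ℝ) ^ k) atTop (𝓝 (4 * R * 0)) :=
      (tendsto_pow_atTop_nhds_zero_of_lt_one (by norm_num) (by norm_num)).const_mul _
    rw [mul_zero] at h1
    filter_upwards [(h1.comp hκtend).eventually_lt_const hr₀] with N hN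
    simpa [div_eq_mul_inv] using hN
  have hlarge : ∀ᶠ N : ℕ in atTop, C ≤ lam * N :=
    (tendsto_natCast_atTop_atTop.const_mul_atTop hlam).eventually_ge_atTop C
  filter_upwards [hball _ Metric.isOpen_ball.measurableSet.compl hνR,
    hnear (fun N => 4 * R / 2 ^ κ N / 2 ^ L) (fun N => by positivity) hsum,
    hexc A hA hνA, hXt] with ω hω₁ hω₂ hω₃ hω
  have hmem : ∀ n, 1 ≤ n → ∃ m < n, X m ω = Xt n ω := fun n hn => by
    simpa [pastInstances] using (hω n hn).1
  have hmin : ∀ n, 1 ≤ n → ∀ m < n, dist (X n ω) (Xt n ω) ≤ dist (X n ω) (X m ω) :=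
    fun n hn m hm => (hω n hn).2 ⟨m, hm, rfl⟩
  filter_upwards [hω₁, hω₂, hω₃, hκ, hr, hlarge] with N h₁ h₂ h₃ hκN hrN hCN
  set r : ℝ := 4 * R / 2 ^ κ N with hrdef
  have hr0 : 0 < r := by positivity
  have hfar := hdoub.countUpTo_far_le (x := fun n => X n ω) (xt := fun n => Xt n ω) hmin (z := z)
    (ρ := r) (k := κ N) hR (by
      have : 0 < R / 2 ^ κ N := by positivity
      rw [hrdef, mul_div_assoc]; linarith) N
  have hnbr := hdoub.countUpTo_neighbor_le (x := fun n => X n ω) (xt := fun n => Xt n ω) hmem hmin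
    A (ρ := r) (ρ' := r / 2 ^ L) (k := L + 3) hr0 (by
      have : 0 < r / 2 ^ L := by positivity
      rw [show 2 * r / 2 ^ (L + 3) = r / 2 ^ L / 4 by rw [pow_add]; field_simp; norm_num]
      linarith) N
  have hcover := countUpTo_mono (N := N) (p := fun n => η (X n ω) ≠ η (Xt n ω))
    (q := fun n => X n ω ∈ (Metric.ball z R)ᶜ ∨ (X n ω ∈ Metric.ball z R ∧
      r < dist (X n ω) (Xt n ω)) ∨ (∃ m < n, dist (X n ω) (X m ω) ≤ r / 2 ^ L) ∨
      (Xt n ω ∈ A ∧ r / 2 ^ L < dist (X n ω) (Xt n ω) ∧ dist (X n ω) (Xt n ω) ≤ r) ∨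
      X n ω ∈ A) (by
    intro n hn _ hne
    by_contra! hcon
    obtain ⟨hin, hle, hgt, hXtA, hXA⟩ := hcon
    rw [Set.notMem_compl_iff] at hin
    have h4 := hle hin
    obtain ⟨m, hm, hmeq⟩ := hmem n hn
    have h5 := hmeq ▸ hgt m hm
    refine hne (hlip _ hXA _ (fun hA' => ?_) (h4.trans_lt hrN))
    exact (hXtA hA' h5).not_ge h4)
  have hsum5 : (countUpTo (fun n => η (X n ω) ≠ η (Xt n ω)) N : ℝ) ≤ _ :=
    Nat.cast_le.2 (hcover.trans ((countUpTo_or_le _ _ N).trans (add_le_add_right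
      ((countUpTo_or_le _ _ N).trans (add_le_add_right ((countUpTo_or_le _ _ N).trans
        (add_le_add_right (countUpTo_or_le _ _ N) _)) _)) _)))
  push_cast at hsum5
  have hN0 : (0 : ℝ) ≤ N := Nat.cast_nonneg N
  have h₄ : (countUpTo (fun n => X n ω ∈ A) N : ℝ) ≤ lam * N :=
    h₃.trans (mul_le_mul_of_nonneg_right (min_le_left _ _) hN0)
  have h₅ : C * (1 + countUpTo (fun n => X n ω ∈ A) N : ℝ) ≤ 2 * lam * N := by
    have h6 : (countUpTo (fun n => X n ω ∈ A) N : ℝ) ≤ lam / C * N :=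
      h₃.trans (mul_le_mul_of_nonneg_right (min_le_right _ _) hN0)
    calc C * (1 + countUpTo (fun n => X n ω ∈ A) N : ℝ) ≤ C * (1 + lam / C * N) := by gcongr
      _ = C + lam * N := by field_simp
      _ ≤ 2 * lam * N := by linarith
  linarith

theorem mainTheorem1 {Ω 𝒳 𝒴 : Type*}
    [MeasurableSpace Ω] (μ : Measure Ω) [IsProbabilityMeasure μ]
    [MetricSpace 𝒳] [TopologicalSpace.SeparableSpace 𝒳] [MeasurableSpace 𝒳] [BorelSpace 𝒳]
    (ν : Measure 𝒳) [IsFiniteMeasure ν] (hν : IsUpperDoubling ν)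
    [Countable 𝒴] [MeasurableSpace 𝒴] [MeasurableSingletonClass 𝒴]
    (X : ℕ → Ω → 𝒳) (hX : ∀ n, Measurable (X n)) (hdom : IsUniformlyDominated X μ ν)
    (η : 𝒳 → 𝒴) (hη : Measurable η) :
    NearestNeighborOnlineConsistent X μ η := by
  intro Xt hXt
  obtain ⟨d, hd, hdoub, c, hc, hball⟩ := hν
  rcases hd.eq_or_lt with rfl | hd
  · have := hdoub.subsingleton
    refine ae_of_all _ fun ω => ?_
    have h : ∀ n, η (X n ω) = η (Xt n ω) := fun n => congrArg η (Subsingleton.elim _ _)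
    simp [mistakeRate, h]
  · obtain ⟨ω₀⟩ := nonempty_of_isProbabilityMeasure μ
    have : Nonempty 𝒳 := ⟨X 0 ω₀⟩
    have hae : ∀ᵐ ω ∂μ, ∀ j : ℕ, ∀ᶠ N in atTop,
        (countUpTo (fun n => η (X n ω) ≠ η (Xt n ω)) N : ℝ) ≤ 6 * (1 / (j + 1)) * N :=
      ae_all_iff.2 fun j => eventually_countUpTo_mistake_le hd hdoub hc hball hX hdom hη hXt
        (by positivity)
    filter_upwards [hae] with ω hω
    simp only [mistakeRate_eq]
    rw [Metric.tendsto_atTop']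
    intro ε hε
    obtain ⟨j, hj⟩ := exists_nat_one_div_lt (show 0 < ε / 6 by positivity)
    obtain ⟨N₀, hN₀⟩ := eventually_atTop.1 (hω j)
    refine ⟨N₀, fun N hN => ?_⟩
    have hNpos : (0 : ℝ) < N := by exact_mod_cast (Nat.zero_le N₀).trans_lt hN
    rw [Real.dist_0_eq_abs, abs_of_nonneg (by positivity), one_div_mul_eq_div, div_lt_iff₀ hNpos]
    refine (hN₀ N hN.le).trans_lt ?_
    gcongr
    linarith
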